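/- A sequence of reals $(x_n)_{n\ge1}$ has Poissonian pair correlation if for every $s>0$ $$\lim_{N\to\infty}\frac1N\,\#\{(m,n):1\le m\ne n\le N,\ \|x_m-x_n\|<s/N\}=2s,$$ where $\|y\|$ is the distance from $y$ to the nearest integer. Let $0<c\le\frac12$ and $g(n)=\frac{(\log n)^c}{n}$ for $n\ge1$. Let $z_1,z_2,\dots$ be independent random variables with $z_n$ uniformly distributed on $[-g(n),g(n)]$ (so $z_1=0$ almost surely, since $g(1)=0$), and let $x_n=n+z_n$. Then, almost surely, for Lebesgue-almost every $\alpha\in\mathbb R$ the sequence $(\alpha x_n)_{n\ge1}$ does not have Poissonian pair correlation. Moreover, almost surely the sequence $(x_n)_{n\ge1}$ itself does not have Poissonian pair correlation. -/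

import Mathlib

open MeasureTheory ProbabilityTheory Filter Topology

noncomputable section

/-- The distance from a real number to the nearest integer. -/
def distNearestInt (y : ℝ) : ℝ := |y - round y|

/-- The number of ordered pairs `(m, n)` with `1 ≤ m ≠ n ≤ N` such that `x m - x n` is at
distance less than `s / N` from the nearest integer. -/
def closePairs (x : ℕ → ℝ) (s : ℝ) (N : ℕ) : ℕ :=
  {p ∈ Finset.Icc 1 N ×ˢ Finset.Icc 1 N |
    p.1 ≠ p.2 ∧ distNearestInt (x p.1 - x p.2) < s / N}.card

/-- The sequence `x 1, x 2, …` has Poissonian pair correlation (`x 0` plays no role). -/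
def PoissonianPairCorrelation (x : ℕ → ℝ) : Prop :=
  ∀ s : ℝ, 0 < s →
    Tendsto (fun N : ℕ => (1 / (N : ℝ)) * (closePairs x s N : ℝ)) atTop (𝓝 (2 * s))

/-- The uniform distribution on the interval `[-r, r]`, for `0 ≤ r`; for `r = 0` it is the point
mass at `0`. -/
def unifSymm (r : ℝ) : Measure ℝ :=
  if 0 < r then cond volume (Set.Icc (-r) r) else Measure.dirac 0

/-- The scale `(log n)^c / n` of the perturbations. -/
def pertScale (c : ℝ) (n : ℕ) : ℝ := Real.log n ^ c / n

end

/-! Almost surely |z_n| ≤ √(log n)/n for all n ≥ 3; from there on the argument is deterministic in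
z. Put θ = qα - p. Modulo 1, αn equals α(n mod q) plus the drift ⌊n/q⌋θ, so the αx_n with N/2 < n ≤
N lie within W/N of q points, where W = N²|θ|/q + 2|α|√(log N). They occupy O(q(W + 1)) cells of
length 1/N, and by Cauchy–Schwarz few cells force many close pairs. Poissonian pair correlation at s
= 1 allows fewer than 3N of these, whence N ≤ 32q(W + 1) for large N
(`PoissonianPairCorrelation.eventually_le`). If |θ| < ε/(q√(log q)) with ε small in terms of α, the
choice N ≈ Aq√(log q) with A large violates this bound. For almost every α infinitely many such q
exist, by the divergence case of Khinchin's theorem (`ae_frequently_abs_mul_sub_lt_of_le_half`). It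
is proved here along the sparse scales Q = 2^((j+1)²): quasi-independence and Kochen–Stone give
positive measure, and Gallagher's zero-one law gives full measure. -/

/-! ### Second-moment Borel–Cantelli. -/

/-- A second moment bound: if the sets `F i` are quasi-independent with constant `C` and their
measures add up to at least `1`, then their union has measure at least `1 / (1 + C)`. -/
theorem inv_one_add_le_measureReal_biUnion {α : Type*} [MeasurableSpace α] {μ : Measure α}
    [IsFiniteMeasure μ] {F : ℕ → Set α} (hF : ∀ i, MeasurableSet (F i)) {C : ℝ} (hC : 0 ≤ C)
    (hquasi : ∀ i j, i ≠ j → μ.real (F i ∩ F j) ≤ C * (μ.real (F i) * μ.real (F j)))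
    (s : Finset ℕ) (hs : 1 ≤ ∑ i ∈ s, μ.real (F i)) :
    1 / (1 + C) ≤ μ.real (⋃ i ∈ s, F i) := by
  classical
  set S := ∑ i ∈ s, μ.real (F i) with hS
  -- This t maximises 2tS - t²(1 + C)S², the lower bound obtained by integrating 2tX - t²X² ≤ 1_{X ≠
  -- 0}, where X counts the `F i` containing x.
  set t : ℝ := 1 / (S * (1 + C)) with ht
  have hint : ∀ A : Set α, MeasurableSet A → Integrable (A.indicator (1 : α → ℝ)) μ :=
    fun A hA => (integrable_const (1 : ℝ)).indicator hA
  have hU : MeasurableSet (⋃ i ∈ s, F i) := Finset.measurableSet_biUnion _ fun i _ => hF i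
  have hI1 : Integrable (fun x => 2 * t * ∑ i ∈ s, (F i).indicator (1 : α → ℝ) x) μ :=
    (integrable_finsetSum _ fun i _ => hint _ (hF i)).const_mul _
  have hI2 : Integrable (fun x => t ^ 2 *
      ∑ i ∈ s, ∑ j ∈ s, (F i ∩ F j).indicator (1 : α → ℝ) x) μ :=
    (integrable_finsetSum _ fun i _ => integrable_finsetSum _ fun j _ =>
      hint _ ((hF i).inter (hF j))).const_mul _
  have hpt : ∀ x, 2 * t * ∑ i ∈ s, (F i).indicator (1 : α → ℝ) x -
      t ^ 2 * ∑ i ∈ s, ∑ j ∈ s, (F i ∩ F j).indicator (1 : α → ℝ) x ≤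
      (⋃ i ∈ s, F i).indicator (1 : α → ℝ) x := by
    intro x
    have hsq : ∑ i ∈ s, ∑ j ∈ s, (F i ∩ F j).indicator (1 : α → ℝ) x =
        (∑ i ∈ s, (F i).indicator (1 : α → ℝ) x) ^ 2 := by
      rw [sq, Finset.sum_mul_sum]
      simp only [Set.inter_indicator_one, Pi.mul_apply]
    rw [hsq]
    by_cases hx : x ∈ ⋃ i ∈ s, F i
    · rw [Set.indicator_of_mem hx, Pi.one_apply]
      nlinarith [sq_nonneg (t * ∑ i ∈ s, (F i).indicator (1 : α → ℝ) x - 1)]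
    · have h0 : ∑ i ∈ s, (F i).indicator (1 : α → ℝ) x = 0 := by
        refine Finset.sum_eq_zero fun i hi => Set.indicator_of_notMem (fun h => hx ?_) _
        exact Set.mem_biUnion hi h
      rw [h0, Set.indicator_of_notMem hx]
      simp
  have hmono := integral_mono (hI1.sub hI2) (hint _ hU) hpt
  rw [integral_indicator_one hU] at hmono
  simp only [Pi.sub_apply] at hmono
  rw [integral_sub hI1 hI2, integral_const_mul, integral_const_mul,
    integral_finsetSum _ fun i _ => hint _ (hF i),
    integral_finsetSum _ fun i _ => integrable_finsetSum _ fun j _ =>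
      hint _ ((hF i).inter (hF j))] at hmono
  simp_rw [integral_finsetSum s fun j _ => hint _ ((hF _).inter (hF j)),
    integral_indicator_one ((hF _).inter (hF _)), integral_indicator_one (hF _)] at hmono
  rw [← hS] at hmono
  have hdouble : ∑ i ∈ s, ∑ j ∈ s, μ.real (F i ∩ F j) ≤ S + C * S ^ 2 := by
    have : ∀ i ∈ s, ∑ j ∈ s, μ.real (F i ∩ F j) ≤ μ.real (F i) + C * (μ.real (F i) * S) := by
      intro i hi
      calc ∑ j ∈ s, μ.real (F i ∩ F j)
          ≤ ∑ j ∈ s, ((if i = j then μ.real (F i) else 0) +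
              C * (μ.real (F i) * μ.real (F j))) := by
            refine Finset.sum_le_sum fun j _ => ?_
            split_ifs with h
            · subst h
              rw [Set.inter_self]
              have : 0 ≤ C * (μ.real (F i) * μ.real (F i)) := by positivity
              linarith
            · simpa using hquasi i j h
        _ = _ := by
            rw [Finset.sum_add_distrib, Finset.sum_ite_eq, if_pos hi, ← Finset.mul_sum,
              ← Finset.mul_sum]
    refine (Finset.sum_le_sum this).trans_eq ?_
    rw [Finset.sum_add_distrib, ← Finset.mul_sum, ← Finset.sum_mul, ← hS]
    ring
  have hSpos : 0 < S := by linarith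
  have key : 1 / (1 + C) ≤ 2 * t * S - t ^ 2 * (S + C * S ^ 2) := by
    have h1 : S + C * S ^ 2 ≤ (1 + C) * S ^ 2 := by nlinarith
    have h2 : t ^ 2 * (S + C * S ^ 2) ≤ t ^ 2 * ((1 + C) * S ^ 2) := by gcongr
    have h3 : 2 * t * S - t ^ 2 * ((1 + C) * S ^ 2) = 1 / (1 + C) := by
      rw [ht]; field_simp; ring
    linarith
  have : t ^ 2 * ∑ i ∈ s, ∑ j ∈ s, μ.real (F i ∩ F j) ≤ t ^ 2 * (S + C * S ^ 2) := by gcongr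
  linarith

/-- The Kochen–Stone form of the second Borel–Cantelli lemma. -/
theorem measure_limsup_pos_of_quasiIndep {α : Type*} [MeasurableSpace α] {μ : Measure α}
    [IsFiniteMeasure μ] {F : ℕ → Set α} (hF : ∀ i, MeasurableSet (F i)) {C : ℝ} (hC : 0 ≤ C)
    (hquasi : ∀ i j, i < j → μ.real (F i ∩ F j) ≤ C * (μ.real (F i) * μ.real (F j)))
    (hsum : ¬ Summable fun i => μ.real (F i)) :
    0 < μ {x | ∃ᶠ i in atTop, x ∈ F i} := by
  have hquasi' : ∀ i j, i ≠ j → μ.real (F i ∩ F j) ≤ C * (μ.real (F i) * μ.real (F j)) := by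
    intro i j hij
    rcases lt_or_gt_of_ne hij with h | h
    · exact hquasi i j h
    · rw [Set.inter_comm, mul_comm (μ.real (F i))]
      exact hquasi j i h
  have htail : ∀ J, ENNReal.ofReal (1 / (1 + C)) ≤ μ (⋃ i, F (i + J)) := by
    intro J
    have h1 : ¬ Summable fun i => μ.real (F (i + J)) := by
      rwa [summable_nat_add_iff (f := fun i => μ.real (F i))]
    rw [not_summable_iff_tendsto_nat_atTop_of_nonneg fun _ => measureReal_nonneg] at h1
    obtain ⟨n, hn⟩ := (h1.eventually_ge_atTop 1).exists
    have := inv_one_add_le_measureReal_biUnion (F := fun i => F (i + J)) (fun i => hF _) hC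
      (fun i j hij => hquasi' _ _ (by omega)) (Finset.range n) hn
    rw [ENNReal.ofReal_le_iff_le_toReal (measure_ne_top _ _)]
    exact this.trans (measureReal_mono (Set.iUnion₂_subset fun i _ =>
      Set.subset_iUnion (fun i => F (i + J)) i))
  have heq : {x | ∃ᶠ i in atTop, x ∈ F i} = ⋂ J, ⋃ i, F (i + J) := by
    ext x
    simp only [Set.mem_ofPred_eq, frequently_atTop, Set.mem_iInter, Set.mem_iUnion]
    refine forall_congr' fun J => ⟨?_, ?_⟩
    · rintro ⟨b, hb, hx⟩
      exact ⟨b - J, by rwa [Nat.sub_add_cancel hb]⟩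
    · rintro ⟨i, hx⟩
      exact ⟨i + J, by omega, hx⟩
  have hanti : Antitone fun J => ⋃ i, F (i + J) := by
    intro J K hJK x hx
    simp only [Set.mem_iUnion] at hx ⊢
    obtain ⟨i, hi⟩ := hx
    exact ⟨i + (K - J), by rwa [show i + (K - J) + J = i + K by omega]⟩
  rw [heq, hanti.measure_iInter
    (fun J => (MeasurableSet.iUnion fun i => hF _).nullMeasurableSet)
    ⟨0, measure_ne_top _ _⟩]
  exact lt_of_lt_of_le (ENNReal.ofReal_pos.2 (by positivity)) (le_iInf htail)

/-! ### Totient sums. -/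

/-- Totients of the integers in `(Q/4, Q]` add up to a positive proportion of `Q ^ 2`. -/
theorem sq_le_sum_totient (Q : ℕ) :
    Q ^ 2 ≤ 16 * ∑ q ∈ Finset.Icc 1 Q with Q < 4 * q, Nat.totient q := by
  -- Sum n = ∑_{d ∣ n} φ(d) over n. The d ≤ Q/4 contribute at most Q²/4 of the total Q(Q + 1)/2, and
  -- the other d have Q / d < 4.
  have h1 : ∑ n ∈ Finset.Icc 1 Q, n = ∑ d ∈ Finset.Icc 1 Q, Nat.totient d * (Q / d) := by
    calc ∑ n ∈ Finset.Icc 1 Q, n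
        = ∑ n ∈ Finset.Icc 1 Q, ∑ d ∈ Finset.Icc 1 Q,
            if d ∣ n then Nat.totient d else 0 := by
          refine Finset.sum_congr rfl fun n hn => ?_
          rw [Finset.mem_Icc] at hn
          conv_lhs => rw [← Nat.sum_totient n]
          rw [← Finset.sum_filter]
          refine Finset.sum_congr ?_ fun _ _ => rfl
          ext d
          simp only [Nat.mem_divisors, Finset.mem_filter, Finset.mem_Icc]
          refine ⟨fun h => ⟨⟨Nat.pos_of_dvd_of_pos h.1 (by omega),
            (Nat.le_of_dvd (by omega) h.1).trans hn.2⟩, h.1⟩, fun h => ⟨h.2, by omega⟩⟩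
      _ = _ := by
          rw [Finset.sum_comm]
          refine Finset.sum_congr rfl fun d _ => ?_
          rw [← Finset.sum_filter, Finset.sum_const, smul_eq_mul, mul_comm]
          congr 1
          exact Nat.Ioc_filter_dvd_card_eq_div Q d
  have h2 : 2 * ∑ n ∈ Finset.Icc 1 Q, n = Q * (Q + 1) := by
    have := Finset.sum_range_id_mul_two (Q + 1)
    rw [Finset.sum_range_eq_add_Ico _ (by omega)] at this
    simp only [zero_add, Nat.add_sub_cancel] at this
    rw [show Finset.Icc 1 Q = Finset.Ico 1 (Q + 1) from rfl]
    linarith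
  have h3 : ∑ d ∈ Finset.Icc 1 Q with ¬ Q < 4 * d, Nat.totient d * (Q / d) ≤ Q / 4 * Q := by
    calc _ ≤ ∑ d ∈ Finset.Icc 1 Q with ¬ Q < 4 * d, Q :=
          Finset.sum_le_sum fun d _ =>
            (Nat.mul_le_mul_right _ (Nat.totient_le d)).trans (Nat.mul_div_le Q d)
      _ ≤ Q / 4 * Q := by
          rw [Finset.sum_const, smul_eq_mul]
          refine Nat.mul_le_mul_right _ ?_
          calc _ ≤ (Finset.Icc 1 (Q / 4)).card := Finset.card_le_card fun d hd => by
                simp only [Finset.mem_filter, Finset.mem_Icc] at hd ⊢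
                omega
            _ = Q / 4 := by simp
  have h4 : ∑ d ∈ Finset.Icc 1 Q with Q < 4 * d, Nat.totient d * (Q / d) ≤
      4 * ∑ q ∈ Finset.Icc 1 Q with Q < 4 * q, Nat.totient q := by
    rw [Finset.mul_sum]
    refine Finset.sum_le_sum fun d hd => ?_
    simp only [Finset.mem_filter, Finset.mem_Icc] at hd
    have : Q / d < 4 := (Nat.div_lt_iff_lt_mul (by omega)).2 hd.2
    nlinarith [Nat.zero_le (Nat.totient d)]
  rw [h1, ← Finset.sum_filter_add_sum_filter_not _ (fun d => Q < 4 * d)] at h2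
  have h5 : 4 * (Q / 4 * Q) ≤ Q * Q := by
    have := Nat.mul_div_le Q 4
    nlinarith
  nlinarith

/-! ### Circle versus line, and unions of balls about separated points. -/

/-- A property that holds almost everywhere on the circle holds almost everywhere on the line. -/
theorem ae_coe_of_ae_unitAddCircle {p : UnitAddCircle → Prop} (h : ∀ᵐ x, p x) :
    ∀ᵐ x : ℝ, p x := by
  have hU : ⋃ n : ℤ, Set.Ioc (n : ℝ) (n + 1) = Set.univ := iUnion_Ioc_intCast ℝ
  rw [← Measure.restrict_univ (μ := (volume : Measure ℝ)), ← hU, ae_restrict_iUnion_iff]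
  intro n
  exact (UnitAddCircle.measurePreserving_mk n).quasiMeasurePreserving.ae h

/-- The number of points of a `d`-separated set in an interval of radius `R`. -/
theorem card_le_of_separated (P : Finset ℝ) {d R a : ℝ} (hd : 0 < d) (hR : 0 ≤ R)
    (hsep : ∀ x ∈ P, ∀ y ∈ P, x ≠ y → d ≤ |x - y|) (hP : ∀ x ∈ P, |a - x| < R) :
    (P.card : ℝ) ≤ 2 * R / d + 1 := by
  have hmaps : ∀ x ∈ P, ⌊(x - (a - R)) / d⌋₊ ∈ Finset.range (⌊2 * R / d⌋₊ + 1) := by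
    intro x hx
    have := abs_lt.1 (hP x hx)
    rw [Finset.mem_range, Nat.lt_succ_iff]
    refine Nat.floor_mono ?_
    gcongr
    linarith
  have hinj : Set.InjOn (fun x => ⌊(x - (a - R)) / d⌋₊) (P : Set ℝ) := by
    intro x hx y hy hxy
    by_contra hne
    have h1 := hsep x hx y hy hne
    have hx' := abs_lt.1 (hP x hx)
    have hy' := abs_lt.1 (hP y hy)
    have hxy' : |(x - (a - R)) / d - (y - (a - R)) / d| < 1 := by
      have e1 := Nat.floor_le (a := (x - (a - R)) / d) (by apply div_nonneg <;> linarith)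
      have e2 := Nat.lt_floor_add_one ((x - (a - R)) / d)
      have e3 := Nat.floor_le (a := (y - (a - R)) / d) (by apply div_nonneg <;> linarith)
      have e4 := Nat.lt_floor_add_one ((y - (a - R)) / d)
      simp only at hxy
      rw [hxy] at e1 e2
      rw [abs_lt]
      constructor <;> linarith
    rw [← sub_div, sub_sub_sub_cancel_right, abs_div, abs_of_pos hd, div_lt_one hd] at hxy'
    linarith
  have := Finset.card_le_card_of_injOn _ hmaps hinj
  rw [Finset.card_range] at this
  calc (P.card : ℝ) ≤ ⌊2 * R / d⌋₊ + 1 := by exact_mod_cast this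
    _ ≤ _ := by gcongr; exact Nat.floor_le (by positivity)

theorem measureReal_biUnion_ball_of_separated {P : Finset ℝ} {d r : ℝ} (hr : 0 ≤ r)
    (hrd : 2 * r ≤ d) (hsep : ∀ x ∈ P, ∀ y ∈ P, x ≠ y → d ≤ |x - y|) :
    volume.real (⋃ x ∈ P, Metric.ball x r) = P.card * (2 * r) := by
  rw [measureReal_biUnion_finset]
  · simp [Real.volume_real_ball hr]
  · intro x hx y hy hxy
    refine Metric.ball_disjoint_ball ?_
    rw [Real.dist_eq]
    linarith [hsep x hx y hy hxy]
  · exact fun _ _ => measurableSet_ball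

/-- Balls about x and y meet only if |x - y| < r + r', and separation limits the number of such y
for each x. -/
theorem measureReal_inter_biUnion_ball_le {P P' : Finset ℝ} {d r r' : ℝ} (hd : 0 < d)
    (hr : 0 ≤ r) (hr' : 0 ≤ r') (hsep : ∀ x ∈ P', ∀ y ∈ P', x ≠ y → d ≤ |x - y|) :
    volume.real ((⋃ x ∈ P, Metric.ball x r) ∩ ⋃ x ∈ P', Metric.ball x r') ≤
      P.card * ((2 * (r + r') / d + 1) * (2 * r')) := by
  have hsub : (⋃ x ∈ P, Metric.ball x r) ∩ ⋃ x ∈ P', Metric.ball x r' ⊆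
      ⋃ x ∈ P, ⋃ y ∈ P'.filter (|x - ·| < r + r'), Metric.ball y r' := by
    rintro u ⟨h1, h2⟩
    simp only [Set.mem_iUnion, Metric.mem_ball, Real.dist_eq, Finset.mem_filter,
      exists_prop] at h1 h2 ⊢
    obtain ⟨x, hx, hxu⟩ := h1
    obtain ⟨y, hy, hyu⟩ := h2
    refine ⟨x, hx, y, ⟨hy, ?_⟩, hyu⟩
    rw [abs_lt] at *
    constructor <;> linarith
  have hfin : volume (⋃ x ∈ P, ⋃ y ∈ P'.filter (|x - ·| < r + r'), Metric.ball y r') ≠ ⊤ := by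
    refine ((measure_biUnion_lt_top P.finite_toSet fun x _ =>
      measure_biUnion_lt_top (Finset.finite_toSet _) fun y _ => measure_ball_lt_top)).ne
  calc _ ≤ volume.real (⋃ x ∈ P, ⋃ y ∈ P'.filter (|x - ·| < r + r'), Metric.ball y r') :=
        measureReal_mono hsub hfin
    _ ≤ ∑ x ∈ P, ∑ y ∈ P' with |x - y| < r + r', volume.real (Metric.ball y r') :=
        (measureReal_biUnion_finset_le _ _).trans
          (Finset.sum_le_sum fun x _ => measureReal_biUnion_finset_le _ _)
    _ ≤ ∑ x ∈ P, (2 * (r + r') / d + 1) * (2 * r') := by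
        refine Finset.sum_le_sum fun x _ => ?_
        simp only [Real.volume_real_ball hr', Finset.sum_const, nsmul_eq_mul]
        gcongr
        refine card_le_of_separated _ (a := x) hd (by positivity) ?_ ?_
        · intro u hu v hv
          exact hsep u (Finset.mem_filter.1 hu).1 v (Finset.mem_filter.1 hv).1
        · exact fun u hu => (Finset.mem_filter.1 hu).2
    _ = _ := by simp

/-! ### Neighbourhoods of reduced fractions. -/

/-- The reduced fractions in `[0, 1)` with denominator in `(Q/4, Q]`. -/
noncomputable def reducedFractions (Q : ℕ) : Finset ℝ :=
  (((Finset.Icc 1 Q).filter fun q => Q < 4 * q).sigma fun q =>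
    (Finset.range q).filter fun p => q.Coprime p).image fun x => (x.2 : ℝ) / (x.1 : ℝ)

theorem mem_reducedFractions {Q : ℕ} {x : ℝ} (hx : x ∈ reducedFractions Q) :
    ∃ q p : ℕ, 1 ≤ q ∧ q ≤ Q ∧ Q < 4 * q ∧ p < q ∧ q.Coprime p ∧ (p : ℝ) / q = x := by
  simp only [reducedFractions, Finset.mem_image, Finset.mem_sigma, Finset.mem_filter,
    Finset.mem_Icc, Finset.mem_range] at hx
  obtain ⟨⟨q, p⟩, ⟨⟨⟨h1, h2⟩, h3⟩, h4, h5⟩, h6⟩ := hx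
  exact ⟨q, p, h1, h2, h3, h4, h5, h6⟩

theorem reducedFractions_separated (Q : ℕ) :
    ∀ x ∈ reducedFractions Q, ∀ y ∈ reducedFractions Q, x ≠ y →
      1 / (Q : ℝ) ^ 2 ≤ |x - y| := by
  intro x hx y hy hxy
  obtain ⟨q, p, hq, hqQ, -, -, -, rfl⟩ := mem_reducedFractions hx
  obtain ⟨q', p', hq', hqQ', -, -, -, rfl⟩ := mem_reducedFractions hy
  have h1 : (0 : ℝ) < q := by exact_mod_cast hq
  have h2 : (0 : ℝ) < q' := by exact_mod_cast hq'
  have h3 : (q : ℝ) ≤ Q := by exact_mod_cast hqQ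
  have h4 : (q' : ℝ) ≤ Q := by exact_mod_cast hqQ'
  have hne : (p : ℤ) * q' - q * p' ≠ 0 := by
    intro h
    apply hxy
    rw [div_eq_div_iff h1.ne' h2.ne']
    have : (p : ℤ) * q' = p' * q := by linarith
    exact_mod_cast this
  have hone : (1 : ℝ) ≤ |(p : ℝ) * q' - q * p'| := by exact_mod_cast Int.one_le_abs hne
  rw [div_sub_div _ _ h1.ne' h2.ne', abs_div, abs_of_pos (mul_pos h1 h2), sq]
  gcongr

theorem card_reducedFractions (Q : ℕ) :
    (reducedFractions Q).card = ∑ q ∈ Finset.Icc 1 Q with Q < 4 * q, Nat.totient q := by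
  rw [reducedFractions, Finset.card_image_of_injOn, Finset.card_sigma]
  · rfl
  · rintro ⟨q, p⟩ hx ⟨q', p'⟩ hy hxy
    simp only [Finset.coe_sigma, Set.mem_sigma_iff, Finset.mem_coe, Finset.mem_filter,
      Finset.mem_Icc, Finset.mem_range] at hx hy hxy
    obtain ⟨⟨⟨h1, h2⟩, h3⟩, h4, h5⟩ := hx
    obtain ⟨⟨⟨h1', h2'⟩, h3'⟩, h4', h5'⟩ := hy
    have e1 : (q : ℝ) ≠ 0 := by exact_mod_cast (by omega : q ≠ 0)
    have e2 : (q' : ℝ) ≠ 0 := by exact_mod_cast (by omega : q' ≠ 0)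
    rw [div_eq_div_iff e1 e2] at hxy
    have hxy' : p * q' = p' * q := by exact_mod_cast hxy
    have d1 : q ∣ q' := h5.dvd_of_dvd_mul_left (hxy' ▸ Dvd.intro_left _ rfl)
    have d2 : q' ∣ q := h5'.dvd_of_dvd_mul_left (hxy' ▸ Dvd.intro_left _ rfl)
    obtain rfl := Nat.dvd_antisymm d1 d2
    obtain rfl := Nat.eq_of_mul_eq_mul_right (by omega) hxy'
    rfl

theorem sq_le_card_reducedFractions (Q : ℕ) :
    (Q : ℝ) ^ 2 ≤ 16 * (reducedFractions Q).card := by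
  rw [card_reducedFractions]
  exact_mod_cast sq_le_sum_totient Q

/-- The points within `ε / ((j + 1) Q²)` of a reduced fraction with denominator in `(Q/4, Q]`,
where `Q = 2 ^ (j + 1) ^ 2`. -/
def nearFractions (ε : ℝ) (j : ℕ) : Set ℝ :=
  ⋃ x ∈ reducedFractions (2 ^ (j + 1) ^ 2),
    Metric.ball x (ε / ((j + 1) * ((2 ^ (j + 1) ^ 2 : ℕ) : ℝ) ^ 2))

theorem measurableSet_nearFractions (ε : ℝ) (j : ℕ) : MeasurableSet (nearFractions ε j) :=
  Finset.measurableSet_biUnion _ fun _ _ => measurableSet_ball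

theorem volume_real_nearFractions {ε : ℝ} (hε : 0 < ε) (hε2 : ε ≤ 1 / 2) (j : ℕ) :
    volume.real (nearFractions ε j) = (reducedFractions (2 ^ (j + 1) ^ 2)).card *
      (2 * (ε / ((j + 1) * ((2 ^ (j + 1) ^ 2 : ℕ) : ℝ) ^ 2))) := by
  refine measureReal_biUnion_ball_of_separated (by positivity) ?_ (reducedFractions_separated _)
  rw [mul_div_assoc', div_le_div_iff₀ (by positivity) (by positivity)]
  have : (1 : ℝ) ≤ (j + 1 : ℝ) := by linarith [(Nat.cast_nonneg j : (0 : ℝ) ≤ j)]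
  calc 2 * ε * ((2 ^ (j + 1) ^ 2 : ℕ) : ℝ) ^ 2 ≤ 1 * ((2 ^ (j + 1) ^ 2 : ℕ) : ℝ) ^ 2 := by
        gcongr; linarith
    _ ≤ 1 * ((j + 1) * ((2 ^ (j + 1) ^ 2 : ℕ) : ℝ) ^ 2) := by
        gcongr; exact le_mul_of_one_le_left (by positivity) this

/-- At least Q²/16 disjoint balls of length 2ε/((j + 1)Q²) give a harmonic lower bound. -/
theorem not_summable_volume_real_nearFractions {ε : ℝ} (hε : 0 < ε) (hε2 : ε ≤ 1 / 2) :
    ¬ Summable fun j => volume.real (nearFractions ε j) := by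
  intro h
  have hle : ∀ j : ℕ, ε / 8 * (1 / ((j + 1 : ℕ) : ℝ)) ≤ volume.real (nearFractions ε j) := by
    intro j
    rw [volume_real_nearFractions hε hε2]
    have h1 := sq_le_card_reducedFractions (2 ^ (j + 1) ^ 2)
    set Q : ℝ := ((2 ^ (j + 1) ^ 2 : ℕ) : ℝ)
    have hQ : 0 < Q := by positivity
    calc ε / 8 * (1 / ((j + 1 : ℕ) : ℝ)) = (Q ^ 2 / 16) * (2 * (ε / ((j + 1) * Q ^ 2))) := by
          push_cast; field_simp; norm_num
      _ ≤ _ := by gcongr; linarith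
  have h2 : Summable fun j : ℕ => ε / 8 * (1 / ((j + 1 : ℕ) : ℝ)) :=
    Summable.of_nonneg_of_le (fun j => by positivity) hle h
  rw [summable_mul_left_iff (by positivity)] at h2
  rw [summable_nat_add_iff (f := fun j : ℕ => 1 / (j : ℝ)) 1] at h2
  exact Real.not_summable_one_div_natCast h2

/-- The scales grow so fast that rQ'² ≥ ε, with r the radius at level i and Q' the scale at level j.
The term +1 in the count of level-j fractions near a level-i ball is thus absorbed into a multiple
of rQ'². -/
theorem volume_real_nearFractions_inter_le {ε : ℝ} (hε : 0 < ε) (hε2 : ε ≤ 1 / 2) {i j : ℕ}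
    (hij : i < j) : volume.real (nearFractions ε i ∩ nearFractions ε j) ≤
      8 * (4 + 1 / ε) * (volume.real (nearFractions ε i) * volume.real (nearFractions ε j)) := by
  rw [volume_real_nearFractions hε hε2, volume_real_nearFractions hε hε2]
  have hcard := sq_le_card_reducedFractions (2 ^ (j + 1) ^ 2)
  have hgrow : (2 ^ (i + 1) ^ 2 : ℕ) * (2 ^ (i + 1) : ℕ) ≤ (2 ^ (j + 1) ^ 2 : ℕ) := by
    rw [← pow_add]
    refine Nat.pow_le_pow_right (by norm_num) ?_
    nlinarith
  have hpow : i + 1 ≤ 2 ^ (i + 1) := Nat.lt_two_pow_self.le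
  have hmain := measureReal_inter_biUnion_ball_le
    (P := reducedFractions (2 ^ (i + 1) ^ 2)) (P' := reducedFractions (2 ^ (j + 1) ^ 2))
    (d := 1 / ((2 ^ (j + 1) ^ 2 : ℕ) : ℝ) ^ 2)
    (r := ε / ((i + 1) * ((2 ^ (i + 1) ^ 2 : ℕ) : ℝ) ^ 2))
    (r' := ε / ((j + 1) * ((2 ^ (j + 1) ^ 2 : ℕ) : ℝ) ^ 2))
    (by positivity) (by positivity) (by positivity) (reducedFractions_separated _)
  refine hmain.trans ?_
  have hQpos : (0 : ℝ) < ((2 ^ (i + 1) ^ 2 : ℕ) : ℝ) := by positivity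
  have hQpos' : (0 : ℝ) < ((2 ^ (j + 1) ^ 2 : ℕ) : ℝ) := by positivity
  have hQQ : ((2 ^ (i + 1) ^ 2 : ℕ) : ℝ) * ((i : ℝ) + 1) ≤ ((2 ^ (j + 1) ^ 2 : ℕ) : ℝ) := by
    exact_mod_cast (Nat.mul_le_mul_left _ hpow).trans hgrow
  generalize ((2 ^ (i + 1) ^ 2 : ℕ) : ℝ) = Q at *
  generalize ((2 ^ (j + 1) ^ 2 : ℕ) : ℝ) = Q' at *
  have hi : (1 : ℝ) ≤ (i : ℝ) + 1 := by linarith [(Nat.cast_nonneg i : (0 : ℝ) ≤ i)]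
  have hijr : (i : ℝ) ≤ j := by exact_mod_cast hij.le
  have hQle : Q ≤ Q' := by nlinarith
  set r := ε / ((i + 1) * Q ^ 2) with hr
  set r' := ε / ((j + 1) * Q' ^ 2) with hr'
  have hr0 : 0 < r := by positivity
  have hr0' : 0 < r' := by positivity
  have hrr : r' ≤ r := by rw [hr, hr']; gcongr
  have hlow : 1 ≤ 1 / ε * (r * Q' ^ 2) := by
    rw [hr]
    have : (1 : ℝ) / ε * (ε / ((i + 1) * Q ^ 2) * Q' ^ 2) = Q' ^ 2 / ((i + 1) * Q ^ 2) := by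
      field_simp
    rw [this, one_le_div (by positivity)]
    calc ((i : ℝ) + 1) * Q ^ 2 ≤ (i + 1) ^ 2 * Q ^ 2 := by gcongr; nlinarith
      _ = (Q * (i + 1)) ^ 2 := by ring
      _ ≤ Q' ^ 2 := by gcongr
  have hfac : 2 * (r + r') / (1 / Q' ^ 2) + 1 ≤ (4 + 1 / ε) * r * Q' ^ 2 := by
    rw [div_div_eq_mul_div, div_one]
    nlinarith [mul_le_mul_of_nonneg_right hrr (sq_nonneg Q')]
  calc _ ≤ ((reducedFractions (2 ^ (i + 1) ^ 2)).card : ℝ) *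
        (((4 + 1 / ε) * r * (16 * (reducedFractions (2 ^ (j + 1) ^ 2)).card)) * (2 * r')) := by
        gcongr
        exact hfac.trans (by gcongr)
    _ = _ := by ring

theorem nearFractions_subset {ε : ℝ} (hε : 0 < ε) (hε2 : ε ≤ 1 / 2) (j : ℕ) :
    nearFractions ε j ⊆ Set.Icc (-1) 2 := by
  intro x hx
  simp only [nearFractions, Set.mem_iUnion, Metric.mem_ball, Real.dist_eq, exists_prop] at hx
  obtain ⟨y, hy, hxy⟩ := hx
  obtain ⟨q, p, hq, -, -, hp, -, rfl⟩ := mem_reducedFractions hy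
  have h1 : (0 : ℝ) < q := by exact_mod_cast hq
  have h2 : (p : ℝ) / q ≤ 1 := by
    rw [div_le_one h1]; exact_mod_cast hp.le
  have h3 : (0 : ℝ) ≤ (p : ℝ) / q := by positivity
  have h4 : ε / ((j + 1) * ((2 ^ (j + 1) ^ 2 : ℕ) : ℝ) ^ 2) ≤ 1 := by
    rw [div_le_one (by positivity)]
    have e1 : (1 : ℝ) ≤ (j : ℝ) + 1 := by linarith [(Nat.cast_nonneg j : (0 : ℝ) ≤ j)]
    have e2 : (1 : ℝ) ≤ ((2 ^ (j + 1) ^ 2 : ℕ) : ℝ) := by exact_mod_cast Nat.one_le_two_pow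
    nlinarith [one_le_pow₀ e2 (n := 2)]
  rw [abs_lt] at hxy
  constructor <;> linarith

theorem mem_addWellApproximable_of_frequently_mem_nearFractions {ε : ℝ} (hε : 0 < ε) {x : ℝ}
    (hx : ∃ᶠ j in atTop, x ∈ nearFractions ε j) :
    (x : UnitAddCircle) ∈ addWellApproximable UnitAddCircle
      fun n => ε / ((n : ℝ) ^ 2 * √(Real.log n)) := by
  rw [UnitAddCircle.mem_addWellApproximable_iff]
  refine Set.infinite_of_forall_exists_gt fun a => ?_
  obtain ⟨j, hj, hxj⟩ := (frequently_atTop.1 hx) (a + 1)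
  simp only [nearFractions, Set.mem_iUnion, Metric.mem_ball, Real.dist_eq, exists_prop] at hxj
  obtain ⟨y, hy, hxy⟩ := hxj
  obtain ⟨q, p, hq, hqQ, hQq, hp, hpq, rfl⟩ := mem_reducedFractions hy
  -- Denominators above Q/4 exceed j, so infinitely many levels yield infinitely many denominators.
  have hgrow : 4 * 2 ^ j ≤ 2 ^ (j + 1) ^ 2 := by
    rw [show 4 = 2 ^ 2 by norm_num, ← pow_add]
    refine Nat.pow_le_pow_right (by norm_num) ?_
    nlinarith
  have hjq : j < q := by
    have : j < 2 ^ j := Nat.lt_two_pow_self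
    omega
  refine ⟨q, ⟨p, hp, Nat.Coprime.symm hpq, ?_⟩, by omega⟩
  have hq1 : (1 : ℝ) < q := by exact_mod_cast (by omega : 1 < q)
  have hlog : 0 < Real.log q := Real.log_pos hq1
  have hlogle : √(Real.log q) ≤ j + 1 := by
    rw [Real.sqrt_le_left (by positivity)]
    have h1 : Real.log q ≤ Real.log ((2 ^ (j + 1) ^ 2 : ℕ) : ℝ) :=
      Real.log_le_log (by linarith) (by exact_mod_cast hqQ)
    have h2 : Real.log ((2 ^ (j + 1) ^ 2 : ℕ) : ℝ) = ((j + 1 : ℕ) : ℝ) ^ 2 * Real.log 2 := by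
      push_cast
      rw [Real.log_pow]
      push_cast
      ring
    have h3 : Real.log 2 ≤ 1 := by linarith [Real.log_two_lt_d9]
    rw [h2] at h1
    push_cast at h1
    nlinarith [sq_nonneg ((j : ℝ) + 1)]
  calc ‖(x : UnitAddCircle) - (((p : ℝ) / q : ℝ) : UnitAddCircle)‖ ≤ |x - (p : ℝ) / q| := by
        rw [← AddCircle.coe_sub, UnitAddCircle.norm_eq]
        simpa using round_le (x - (p : ℝ) / q) 0
    _ < _ := hxy
    _ ≤ ε / ((q : ℝ) ^ 2 * √(Real.log q)) := by
        rw [mul_comm ((j : ℝ) + 1)]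
        have : (q : ℝ) ≤ ((2 ^ (j + 1) ^ 2 : ℕ) : ℝ) := by exact_mod_cast hqQ
        have hs : 0 < √(Real.log q) := Real.sqrt_pos.2 hlog
        gcongr

/-! ### Khinchin's theorem, divergence case. -/

/-- An instance of the divergence part of Khinchin's theorem. -/
theorem ae_frequently_abs_mul_sub_lt_of_le_half {ε : ℝ} (hε : 0 < ε) (hε2 : ε ≤ 1 / 2) :
    ∀ᵐ α : ℝ, ∃ᶠ q : ℕ in atTop, ∃ p : ℤ, |q * α - p| < ε / (q * √(Real.log q)) := by
  set δ : ℕ → ℝ := fun n => ε / ((n : ℝ) ^ 2 * √(Real.log n)) with hδ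
  have hδ0 : Tendsto δ atTop (𝓝 0) := by
    refine squeeze_zero' (Eventually.of_forall fun n => by positivity) ?_
      (tendsto_const_div_atTop_nhds_zero_nat ε)
    filter_upwards [eventually_ge_atTop 3] with n hn
    have h3 : (3 : ℝ) ≤ n := by exact_mod_cast hn
    have hlog : 1 ≤ Real.log n := by
      rw [Real.le_log_iff_exp_le (by linarith)]
      linarith [Real.exp_one_lt_d9]
    have hs : 1 ≤ √(Real.log n) := Real.one_le_sqrt.2 hlog
    simp only [hδ]
    gcongr
    nlinarith
  -- Kochen–Stone needs a finite measure, hence the restriction to an interval containing every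
  -- `nearFractions ε j`.
  have hpos : 0 < volume.restrict (Set.Icc (-1 : ℝ) 2)
      {x | ∃ᶠ j in atTop, x ∈ nearFractions ε j} := by
    have hres : ∀ A : Set ℝ, A ⊆ Set.Icc (-1) 2 →
        (volume.restrict (Set.Icc (-1 : ℝ) 2)).real A = volume.real A := by
      intro A hA
      rw [measureReal_restrict_apply' measurableSet_Icc, Set.inter_eq_left.2 hA]
    have hsub := nearFractions_subset hε hε2
    refine measure_limsup_pos_of_quasiIndep (measurableSet_nearFractions ε)
      (C := 8 * (4 + 1 / ε)) (by positivity) (fun i j hij => ?_) ?_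
    · rw [hres _ (hsub i), hres _ (hsub j), hres _ (Set.inter_subset_left.trans (hsub i))]
      exact volume_real_nearFractions_inter_le hε hε2 hij
    · simp_rw [fun i => hres _ (hsub i)]
      exact not_summable_volume_real_nearFractions hε hε2
  have hmem : ∀ᵐ x : UnitAddCircle, x ∈ addWellApproximable UnitAddCircle δ := by
    -- Gallagher's zero-one law: positive measure excludes the null alternative.
    refine (AddCircle.addWellApproximable_ae_empty_or_univ δ hδ0).resolve_left fun h => ?_
    have h1 : ∀ᵐ x : ℝ, (x : UnitAddCircle) ∉ addWellApproximable UnitAddCircle δ :=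
      ae_coe_of_ae_unitAddCircle h
    have h2 : ∀ᵐ x : ℝ, ¬ ∃ᶠ j in atTop, x ∈ nearFractions ε j :=
      h1.mono fun x hx h => hx (mem_addWellApproximable_of_frequently_mem_nearFractions hε h)
    have h3 := ae_restrict_of_ae (s := Set.Icc (-1 : ℝ) 2) h2
    rw [ae_iff] at h3
    simp only [not_not] at h3
    exact hpos.ne' h3
  filter_upwards [ae_coe_of_ae_unitAddCircle hmem] with α hα
  rw [UnitAddCircle.mem_addWellApproximable_iff] at hα
  rw [Nat.frequently_atTop_iff_infinite]
  refine hα.mono ?_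
  rintro n ⟨m, hmn, -, hlt⟩
  have hn : (0 : ℝ) < n := by exact_mod_cast (by omega : 0 < n)
  rw [← AddCircle.coe_sub, UnitAddCircle.norm_eq] at hlt
  refine ⟨m + n * round (α - (m : ℝ) / n), ?_⟩
  set k := round (α - (m : ℝ) / n)
  have : (n : ℝ) * α - ((m + n * k : ℤ) : ℝ) = n * (α - (m : ℝ) / n - k) := by
    push_cast
    field_simp
    ring
  rw [this, abs_mul, abs_of_pos hn]
  calc (n : ℝ) * |α - (m : ℝ) / n - k| < n * (ε / ((n : ℝ) ^ 2 * √(Real.log n))) := by gcongr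
    _ = _ := by rw [mul_div_assoc', sq, mul_assoc, mul_div_mul_left _ _ hn.ne']

theorem ae_frequently_abs_mul_sub_lt {ε : ℝ} (hε : 0 < ε) :
    ∀ᵐ α : ℝ, ∃ᶠ q : ℕ in atTop, ∃ p : ℤ, |q * α - p| < ε / (q * √(Real.log q)) := by
  filter_upwards [ae_frequently_abs_mul_sub_lt_of_le_half (ε := min ε (1 / 2)) (by positivity)
    (min_le_right _ _)] with α hα
  refine hα.mono fun q ⟨p, hp⟩ => ⟨p, hp.trans_le ?_⟩
  gcongr
  exact min_le_left _ _

/-! ### From good rational approximation to too many close pairs. -/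

/-- If points in the same cell are close modulo `1`, then few cells force many close pairs. -/
theorem sq_card_le_card_mul_closePairs {β : Type*} [DecidableEq β] {x : ℕ → ℝ} {s : ℝ} {N : ℕ}
    {S : Finset ℕ} (hS : S ⊆ Finset.Icc 1 N) (f : ℕ → β) {T : Finset β}
    (hf : ∀ n ∈ S, f n ∈ T)
    (hclose : ∀ m ∈ S, ∀ n ∈ S, f m = f n → distNearestInt (x m - x n) < s / N) :
    S.card ^ 2 ≤ T.card * (S.card + closePairs x s N) := by
  have h1 : S.card = ∑ t ∈ T, (S.filter fun n => f n = t).card :=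
    Finset.card_eq_sum_card_fiberwise hf
  have h2 : ∑ t ∈ T, (S.filter fun n => f n = t).card ^ 2 =
      ((S ×ˢ S).filter fun e => f e.1 = f e.2).card := by
    rw [Finset.card_eq_sum_card_fiberwise (f := fun e : ℕ × ℕ => f e.1) (t := T)]
    · refine Finset.sum_congr rfl fun t _ => ?_
      rw [sq, ← Finset.card_product]
      congr 1
      ext ⟨m, n⟩
      simp only [Finset.mem_product, Finset.mem_filter]
      constructor
      · rintro ⟨⟨hm, hmt⟩, hn, hnt⟩
        exact ⟨⟨⟨hm, hn⟩, hmt.trans hnt.symm⟩, hmt⟩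
      · rintro ⟨⟨⟨hm, hn⟩, hmn⟩, hmt⟩
        exact ⟨⟨hm, hmt⟩, hn, hmn ▸ hmt⟩
    · intro e he
      exact hf _ (Finset.mem_product.1 (Finset.mem_filter.1 he).1).1
  -- The diagonal, which `closePairs` excludes, accounts for the term `S.card`.
  have h3 : ((S ×ˢ S).filter fun e => f e.1 = f e.2).card ≤ S.card + closePairs x s N := by
    rw [closePairs, ← Finset.diag_card S]
    refine (Finset.card_le_card fun e he => ?_).trans (Finset.card_union_le _ _)
    simp only [Finset.mem_filter, Finset.mem_product] at he
    obtain ⟨⟨he1, he2⟩, hef⟩ := he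
    rw [Finset.mem_union, Finset.mem_diag]
    by_cases h : e.1 = e.2
    · exact Or.inl ⟨he1, h⟩
    · exact Or.inr (Finset.mem_filter.2 ⟨Finset.mem_product.2 ⟨hS he1, hS he2⟩, h,
        hclose _ he1 _ he2 hef⟩)
  calc S.card ^ 2 = (∑ t ∈ T, (S.filter fun n => f n = t).card) ^ 2 := by rw [← h1]
    _ ≤ T.card * ∑ t ∈ T, (S.filter fun n => f n = t).card ^ 2 := sq_sum_le_card_mul_sum_sq
    _ ≤ _ := by rw [h2]; gcongr

theorem distNearestInt_le (y : ℝ) (k : ℤ) : distNearestInt y ≤ |y - k| := round_le y k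

theorem abs_sub_lt_of_floor_mul_eq {u v N : ℝ} (hN : 0 < N) (h : ⌊u * N⌋ = ⌊v * N⌋) :
    |u - v| < 1 / N := by
  have := Int.abs_sub_lt_one_of_floor_eq_floor h
  rwa [← sub_mul, abs_mul, abs_of_pos hN, ← lt_div_iff₀ hN] at this

/-- Poissonian pair correlation of `α (n + z n)` with small perturbations `z n` bounds how well
`α` is approximated by rationals. -/
theorem PoissonianPairCorrelation.eventually_le {z : ℕ → ℝ}
    (hz : ∀ n : ℕ, 3 ≤ n → |z n| ≤ √(Real.log n) / n) {α : ℝ}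
    (h : PoissonianPairCorrelation fun n => α * ((n : ℝ) + z n)) :
    ∀ᶠ N : ℕ in atTop, ∀ q : ℕ, 1 ≤ q → ∀ p : ℤ,
      (N : ℝ) ≤ 32 * q * ((N : ℝ) ^ 2 * |q * α - p| / q + 2 * |α| * √(Real.log N) + 1) := by
  have hlt := (h 1 one_pos).eventually_lt_const (show (2 * 1 : ℝ) < 3 by norm_num)
  filter_upwards [hlt, eventually_ge_atTop 6] with N hN hN6 q hq p
  have hN0 : (0 : ℝ) < N := by exact_mod_cast (by omega : 0 < N)
  have hq0 : (0 : ℝ) < q := by exact_mod_cast hq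
  set θ : ℝ := q * α - p with hθ
  set W : ℝ := (N : ℝ) ^ 2 * |θ| / q + 2 * |α| * √(Real.log N) with hW
  have hW0 : 0 ≤ W := by positivity
  set u : ℕ → ℝ := fun n => ((n / q : ℕ) : ℝ) * θ + α * z n with hu
  -- Only n > N/2 are used, so that |z n| ≤ 2√(log N)/N uniformly. A cell records the residue n mod
  -- q and the position of the displacement `u n` on the grid of mesh 1/N.
  have hpair := sq_card_le_card_mul_closePairs (x := fun n => α * ((n : ℝ) + z n)) (s := 1)
    (N := N) (S := Finset.Ioc (N / 2) N) (fun n hn => by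
      simp only [Finset.mem_Ioc, Finset.mem_Icc] at hn ⊢; omega)
    (fun n => (n % q, ⌊u n * N⌋)) (T := Finset.range q ×ˢ Finset.Icc ⌊-W⌋ ⌊W⌋) ?_ ?_
  · have hScard : (N : ℝ) / 2 ≤ (Finset.Ioc (N / 2) N).card := by
      rw [Nat.card_Ioc, div_le_iff₀ two_pos]
      exact_mod_cast (by omega : N ≤ (N - N / 2) * 2)
    have hScard' : ((Finset.Ioc (N / 2) N).card : ℝ) ≤ N := by
      rw [Nat.card_Ioc]
      exact_mod_cast Nat.sub_le _ _
    have hTcard : ((Finset.range q ×ˢ Finset.Icc ⌊-W⌋ ⌊W⌋).card : ℝ) ≤ q * (2 * W + 2) := by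
      rw [Finset.card_product, Finset.card_range, Int.card_Icc, Nat.cast_mul]
      gcongr
      have hle : ⌊-W⌋ ≤ ⌊W⌋ := Int.floor_mono (by linarith)
      rw [← Int.cast_natCast, Int.toNat_of_nonneg (by omega)]
      push_cast
      linarith [Int.floor_le W, Int.lt_floor_add_one (-W)]
    have hpairs : (closePairs (fun n => α * ((n : ℝ) + z n)) 1 N : ℝ) ≤ 3 * N := by
      rw [one_div, inv_mul_lt_iff₀ hN0] at hN
      linarith
    have hpairR : ((Finset.Ioc (N / 2) N).card : ℝ) ^ 2 ≤
        ((Finset.range q ×ˢ Finset.Icc ⌊-W⌋ ⌊W⌋).card : ℝ) * ((Finset.Ioc (N / 2) N).card +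
          closePairs (fun n => α * ((n : ℝ) + z n)) 1 N) := by exact_mod_cast hpair
    have : (N / 2 : ℝ) ^ 2 ≤ q * (2 * W + 2) * (N + 3 * N) :=
      calc (N / 2 : ℝ) ^ 2 ≤ ((Finset.Ioc (N / 2) N).card : ℝ) ^ 2 := by gcongr
        _ ≤ _ := hpairR
        _ ≤ _ := by gcongr
    have h2 : (N : ℝ) * N ≤ N * (32 * q * (W + 1)) := by linarith
    exact le_of_mul_le_mul_left h2 hN0
  · intro n hn
    rw [Finset.mem_Ioc] at hn
    have hn3 : 3 ≤ n := by omega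
    have hn0 : (0 : ℝ) < n := by exact_mod_cast (by omega : 0 < n)
    have hnN : (n : ℝ) ≤ N := by exact_mod_cast hn.2
    have hNn : (N : ℝ) ≤ 2 * n := by exact_mod_cast (by omega : N ≤ 2 * n)
    have hzn : |z n| * N ≤ 2 * √(Real.log N) := by
      have h1 := hz n hn3
      rw [le_div_iff₀ hn0] at h1
      have h2 : √(Real.log n) ≤ √(Real.log N) :=
        Real.sqrt_le_sqrt (Real.log_le_log hn0 hnN)
      nlinarith [abs_nonneg (z n)]
    have hdiv : ((n / q : ℕ) : ℝ) ≤ N / q := by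
      refine Nat.cast_div_le.trans ?_
      gcongr
    have hunW : |u n * N| ≤ W := by
      rw [abs_mul, abs_of_pos hN0]
      calc |u n| * N ≤ (((n / q : ℕ) : ℝ) * |θ| + |α| * |z n|) * N := by
            gcongr
            refine (abs_add_le _ _).trans_eq ?_
            rw [abs_mul, abs_mul, Nat.abs_cast]
        _ = ((n / q : ℕ) : ℝ) * |θ| * N + |α| * (|z n| * N) := by ring
        _ ≤ N / q * |θ| * N + |α| * (2 * √(Real.log N)) := by gcongr
        _ = W := by rw [hW]; ring
    rw [abs_le] at hunW
    simp only [Finset.mem_product, Finset.mem_range, Finset.mem_Icc]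
    exact ⟨Nat.mod_lt _ (by omega), Int.floor_mono hunW.1, Int.floor_mono hunW.2⟩
  · intro m _ n _ hmn
    simp only [Prod.mk.injEq] at hmn
    obtain ⟨hmod, hfl⟩ := hmn
    have hdecomp : ∀ k : ℕ, α * ((k : ℝ) + z k) =
        u k + α * ((k % q : ℕ) : ℝ) + (((k / q : ℕ) : ℤ) * p : ℤ) := by
      intro k
      have : (k : ℝ) = (q : ℝ) * ((k / q : ℕ) : ℝ) + ((k % q : ℕ) : ℝ) := by
        exact_mod_cast (Nat.div_add_mod k q).symm
      conv_lhs => rw [this]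
      rw [hu, hθ, Int.cast_mul, Int.cast_natCast]
      ring
    refine lt_of_le_of_lt (distNearestInt_le _
      (((m / q : ℕ) : ℤ) * p - ((n / q : ℕ) : ℤ) * p)) ?_
    have : α * ((m : ℝ) + z m) - α * ((n : ℝ) + z n) -
        ((((m / q : ℕ) : ℤ) * p - ((n / q : ℕ) : ℤ) * p : ℤ) : ℝ) = u m - u n := by
      rw [hdecomp m, hdecomp n, hmod, Int.cast_sub]
      ring
    rw [this]
    exact abs_sub_lt_of_floor_mul_eq hN0 hfl

theorem not_poissonianPairCorrelation_of_frequently {z : ℕ → ℝ}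
    (hz : ∀ n : ℕ, 3 ≤ n → |z n| ≤ √(Real.log n) / n) {α : ℝ}
    (hα : ∃ᶠ q : ℕ in atTop, ∃ p : ℤ,
      |q * α - p| < 1 / (4 * (65 + 128 * |α|) ^ 2) / (q * √(Real.log q))) :
    ¬ PoissonianPairCorrelation fun n => α * ((n : ℝ) + z n) := by
  intro h
  obtain ⟨N₀, hN₀⟩ := eventually_atTop.1 (h.eventually_le hz)
  -- With l = √(log q) and N ≈ Aql, the bound becomes N ≤ (64 + 128|α|)ql, which A just exceeds. The
  -- factor 1/(4A²) in the hypothesis makes the drift term N²|qα - p|/q at most l.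
  set A : ℝ := 65 + 128 * |α| with hA
  have hA1 : 65 ≤ A := by linarith [abs_nonneg α]
  obtain ⟨q, hq, p, hp⟩ := frequently_atTop.1 hα (max N₀ (max 3 ⌈2 * A⌉₊))
  simp only [max_le_iff] at hq
  obtain ⟨hqN, hq3, hqA⟩ := hq
  have hq3R : (3 : ℝ) ≤ q := by exact_mod_cast hq3
  have hqAR : 2 * A ≤ q := Nat.ceil_le.1 hqA
  have hq0 : (0 : ℝ) < q := by linarith
  have hlog : 1 ≤ Real.log q := by
    rw [Real.le_log_iff_exp_le hq0]
    linarith [Real.exp_one_lt_d9]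
  set l : ℝ := √(Real.log q) with hl
  have hl1 : 1 ≤ l := Real.one_le_sqrt.2 hlog
  have hlsq : l ^ 2 = Real.log q := Real.sq_sqrt (by linarith)
  have hlq : l ≤ q := by nlinarith [Real.log_le_self hq0.le]
  set N : ℕ := ⌈A * q * l⌉₊ with hN
  have hNlow : A * q * l ≤ N := Nat.le_ceil _
  have hql : (q : ℝ) ≤ q * l := le_mul_of_one_le_right hq0.le hl1
  have hNup : (N : ℝ) ≤ 2 * A * q * l := by
    have : (N : ℝ) < A * q * l + 1 := Nat.ceil_lt_add_one (by positivity)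
    nlinarith
  have hqleN : (q : ℝ) ≤ N := by nlinarith
  have hN0 : (0 : ℝ) < N := by linarith
  have hlogN : √(Real.log N) ≤ 2 * l := by
    rw [Real.sqrt_le_left (by positivity)]
    have h1 : (N : ℝ) ≤ (q : ℝ) ^ 4 :=
      calc (N : ℝ) ≤ 2 * A * q * l := hNup
        _ ≤ q * q * q := by gcongr
        _ ≤ (q : ℝ) ^ 4 := by
          rw [show (q : ℝ) * q * q = q ^ 3 by ring]
          exact pow_le_pow_right₀ (by linarith) (by norm_num)
    have h2 := Real.log_le_log hN0 h1
    rw [Real.log_pow] at h2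
    push_cast at h2
    rw [mul_pow, hlsq]
    linarith
  have happrox : (N : ℝ) ^ 2 * |q * α - p| / q ≤ l :=
    calc (N : ℝ) ^ 2 * |q * α - p| / q
        ≤ (2 * A * q * l) ^ 2 * (1 / (4 * A ^ 2) / (q * l)) / q := by gcongr
      _ = l := by field_simp; norm_num
  have hbound := hN₀ N (by exact_mod_cast (by exact_mod_cast hqN : (N₀ : ℝ) ≤ q).trans hqleN)
    q (by omega) p
  have : (N : ℝ) ≤ 32 * q * (l + 2 * |α| * (2 * l) + l) := by
    refine hbound.trans ?_
    gcongr
  have hpos : 0 < (q : ℝ) * l := by positivity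
  have h5 : A * (q * l) ≤ (64 + 128 * |α|) * (q * l) := by linarith
  have := le_of_mul_le_mul_right h5 hpos
  linarith

/-- Here α = 1, so q = p = 1 leaves no drift and the bound reads N ≤ 32(2√(log N) + 1). -/
theorem not_poissonianPairCorrelation_natCast_add {z : ℕ → ℝ}
    (hz : ∀ n : ℕ, 3 ≤ n → |z n| ≤ √(Real.log n) / n) :
    ¬ PoissonianPairCorrelation fun n => (n : ℝ) + z n := by
  intro h
  have h1 : PoissonianPairCorrelation fun n => (1 : ℝ) * ((n : ℝ) + z n) := by
    simpa only [one_mul] using h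
  obtain ⟨N, hN, hN4⟩ := ((h1.eventually_le hz).and (eventually_ge_atTop 10000)).exists
  have h2 := hN 1 le_rfl 1
  have hN4R : (10000 : ℝ) ≤ N := by exact_mod_cast hN4
  have hsqrt : √(Real.log N) ≤ √(N : ℝ) := Real.sqrt_le_sqrt (Real.log_le_self (by linarith))
  have hlarge : 100 ≤ √(N : ℝ) := Real.le_sqrt_of_sq_le (by linarith)
  have hsq : √(N : ℝ) ^ 2 = N := Real.sq_sqrt (by linarith)
  norm_num at h2
  nlinarith

/-! ### Size of the random perturbations, and conclusion. -/

theorem unifSymm_compl_Icc {r : ℝ} (hr : 0 < r) : unifSymm r (Set.Icc (-r) r)ᶜ = 0 := by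
  rw [unifSymm, if_pos hr, cond_apply measurableSet_Icc, Set.inter_compl_self, measure_empty,
    mul_zero]

/-- From n = 3 on log n ≥ 1, so its powers increase with the exponent. -/
theorem pertScale_le {c : ℝ} (hc : c ≤ 1 / 2) {n : ℕ} (hn : 3 ≤ n) :
    0 < pertScale c n ∧ pertScale c n ≤ √(Real.log n) / n := by
  have hn3 : (3 : ℝ) ≤ n := by exact_mod_cast hn
  have hlog : 1 ≤ Real.log n := by
    rw [Real.le_log_iff_exp_le (by linarith)]
    linarith [Real.exp_one_lt_d9]
  refine ⟨div_pos (Real.rpow_pos_of_pos (by linarith) _) (by linarith), ?_⟩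
  rw [pertScale, Real.sqrt_eq_rpow]
  gcongr

theorem ae_abs_le_sqrt_log_div {Ω : Type*} [MeasurableSpace Ω] {P : Measure Ω} {c : ℝ}
    (hc : c ≤ 1 / 2) {z : ℕ → Ω → ℝ}
    (hlaw : ∀ n : ℕ, 1 ≤ n → HasLaw (z n) (unifSymm (pertScale c n)) P) :
    ∀ᵐ ω ∂P, ∀ n : ℕ, 3 ≤ n → |z n ω| ≤ √(Real.log n) / n := by
  rw [ae_all_iff]
  intro n
  by_cases hn : 3 ≤ n
  · obtain ⟨hpos, hle⟩ := pertScale_le hc hn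
    have hX := hlaw n (by omega)
    have h0 : P.map (z n) (Set.Icc (-pertScale c n) (pertScale c n))ᶜ = 0 := by
      rw [hX.map_eq]
      exact unifSymm_compl_Icc hpos
    have h1 : ∀ᵐ y ∂(P.map (z n)), y ∈ Set.Icc (-pertScale c n) (pertScale c n) := h0
    filter_upwards [ae_of_ae_map hX.aemeasurable h1] with ω hω _
    exact (abs_le.2 hω).trans hle
  · exact Eventually.of_forall fun ω h => absurd h hn

/-- The required ε depends on α, so one null set must serve all ε; the values 1/(k + 1) suffice. -/
theorem ae_forall_frequently_abs_mul_sub_lt :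
    ∀ᵐ α : ℝ, ∀ ε : ℝ, 0 < ε →
      ∃ᶠ q : ℕ in atTop, ∃ p : ℤ, |q * α - p| < ε / (q * √(Real.log q)) := by
  have h : ∀ᵐ α : ℝ, ∀ k : ℕ, ∃ᶠ q : ℕ in atTop, ∃ p : ℤ,
      |q * α - p| < 1 / ((k : ℝ) + 1) / (q * √(Real.log q)) :=
    ae_all_iff.2 fun k => ae_frequently_abs_mul_sub_lt (by positivity)
  filter_upwards [h] with α hα ε hε
  obtain ⟨k, hk⟩ := exists_nat_one_div_lt hε
  refine (hα k).mono fun q ⟨p, hp⟩ => ⟨p, hp.trans_le ?_⟩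
  gcongr

theorem theorem3 {Ω : Type*} [MeasurableSpace Ω] (P : Measure Ω) [IsProbabilityMeasure P]
    (c : ℝ) (hc0 : 0 < c) (hc : c ≤ 1 / 2)
    (z : ℕ → Ω → ℝ)
    (hlaw : ∀ n : ℕ, 1 ≤ n → HasLaw (z n) (unifSymm (pertScale c n)) P)
    (hindep : iIndepFun (fun n : ℕ+ => z n) P) :
    (∀ᵐ ω ∂P, ∀ᵐ α : ℝ, ¬ PoissonianPairCorrelation (fun n => α * ((n : ℝ) + z n ω))) ∧
    (∀ᵐ ω ∂P, ¬ PoissonianPairCorrelation (fun n => (n : ℝ) + z n ω)) := by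
  have hz := ae_abs_le_sqrt_log_div hc hlaw
  constructor
  · filter_upwards [hz] with ω hω
    filter_upwards [ae_forall_frequently_abs_mul_sub_lt] with α hα
    exact not_poissonianPairCorrelation_of_frequently hω (hα _ (by positivity))
  · filter_upwards [hz] with ω hω
    exact not_poissonianPairCorrelation_natCast_add hω
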